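/- Let $\ell \ge 1$, $\alpha \ge 2$ and $c \ge 1$ be integers with $c$ odd. Let $\Gamma$ be a finite abelian group of order $(2\ell+1)\,2^{\alpha}\,c$ which has either no involution or at least two involutions (an involution is an element of order $2$). Then there exists a $\Gamma$-magic rectangle set $\mathrm{MRS}_\Gamma(2\ell+1, 2^{\alpha}; c)$, that is, a collection of $c$ arrays with $2\ell+1$ rows and $2^{\alpha}$ columns, whose entries are the elements of $\Gamma$, each element of $\Gamma$ appearing exactly once and in a unique array, such that for some $\omega, \delta \in \Gamma$ every row of every array has sum $\omega$ and every column of every array has sum $\delta$. -/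

import Mathlib

/-- The class `Υ`: finite abelian groups having zero or at least two involutions
(elements of order two). -/
def InUpsilon (Γ : Type*) [AddCommGroup Γ] : Prop :=
  Finite Γ ∧ ({g : Γ | addOrderOf g = 2}.ncard = 0 ∨ 2 ≤ {g : Γ | addOrderOf g = 2}.ncard)

/-- `IsMRS a b c R`: the `c` arrays `R 0, …, R (c - 1)`, of size `a × b` (that is, `a` rows and
`b` columns), form a `Γ`-magic rectangle set `MRS_Γ(a, b; c)`. -/
structure IsMRS {Γ : Type*} [AddCommGroup Γ] (a b c : ℕ)
    (R : Fin c → Matrix (Fin a) (Fin b) Γ) : Prop where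
  /-- The group has order `abc`. -/
  card_eq : Nat.card Γ = a * b * c
  /-- Every element of the group appears once and in a unique array. -/
  exists_unique : ∀ g : Γ, ∃! p : Fin c × Fin a × Fin b, R p.1 p.2.1 p.2.2 = g
  /-- All rows of all arrays have the same sum. -/
  row_sum : ∃ ω : Γ, ∀ t i, ∑ j, R t i j = ω
  /-- All columns of all arrays have the same sum. -/
  col_sum : ∃ δ : Γ, ∀ t j, ∑ i, R t i j = δ

/-! Write Γ = H × K with H of order 2^α and K of odd order. Γ has even order, so it has at least two
involutions, and these lie in H. For T ≤ K of order c put L = K/T, of order 2ℓ+1. It suffices to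
arrange H × L in one array with zero line sums and to lift it along Γ → H × L, whose kernel has odd
order c: adding g i * χ j times the kernel element t to entry (i, j) gives the c arrays, provided g
and χ sum to zero and take values prime to c (`HasZeroSumArray.exists_lift`).

For H × L, rows are indexed by L. All rows outside a small symmetric set come in cancelling pairs x,
-x (`of_block`). If |H| ≥ 8 the set is {0, k, -k}, and the block comes from a bijection b of H for
which h + b h and h + 2 b h are bijections too: column h holds (h, 0), (b h, k), (-h - b h, -k), the
last two swapped on half of the columns to balance the rows. Such b exist on 2-groups with two
involutions, since the property passes to extensions and holds for ZMod 2 × ZMod (2 ^ (a + 1)) and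
(ZMod 2)³. The Klein group, where this balancing fails, gets explicit blocks. -/

/-- A complete mapping `b` of an additive group for which `h ↦ h + 2 • b h` is injective too. -/
def HasStrongCompleteMapping (H : Type*) [AddCommGroup H] : Prop :=
  ∃ b : H → H, Function.Injective b ∧ Function.Injective (fun h => h + b h) ∧
    Function.Injective (fun h => h + (2 : ℕ) • b h)

/-! ### Strong complete mappings: extensions and small groups. -/

namespace HasStrongCompleteMapping

/-- Strong complete mappings pass to group extensions. -/
theorem of_exact {N H Q : Type*} [AddCommGroup N] [AddCommGroup H] [AddCommGroup Q]
    (i : N →+ H) (p : H →+ Q) (hi : Function.Injective i) (hp : Function.Surjective p)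
    (hpi : ∀ n, p (i n) = 0) (hker : ∀ h, p h = 0 → ∃ n, i n = h)
    (hN : HasStrongCompleteMapping N) (hQ : HasStrongCompleteMapping Q) :
    HasStrongCompleteMapping H := by
  obtain ⟨bN, hN0, hN1, hN2⟩ := hN
  obtain ⟨bQ, hQ0, hQ1, hQ2⟩ := hQ
  choose u hu using hp
  have h1 : ∀ h, ∃ n, i n = h - u (p h) := fun h => hker _ (by simp [hu])
  choose ν hν using h1
  have hdec : ∀ h, h = u (p h) + i (ν h) := fun h => by rw [hν]; abel
  -- In the coordinates h = u (p h) + i (ν h), all three maps are triangular: the quotient part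
  -- determines p h, after which the kernel part determines ν h.
  have main : ∀ (F : H → H) (w : Q → H) (FN : N → N) (FQ : Q → Q), Function.Injective FN →
      Function.Injective FQ → (∀ h, F h = w (p h) + i (FN (ν h))) →
      (∀ q, p (w q) = FQ q) → Function.Injective F := by
    intro F w FN FQ hFN hFQ hF hw h h' e
    rw [hF, hF] at e
    have e1 : p h = p h' := hFQ (by simpa [hw, hpi] using congrArg p e)
    have e2 : ν h = ν h' := hFN (hi (by simpa [e1] using e))
    rw [hdec h, hdec h', e1, e2]
  refine ⟨fun h => u (bQ (p h)) + i (bN (ν h)),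
    main _ (fun q => u (bQ q)) bN bQ hN0 hQ0 (fun _ => rfl) (fun _ => hu _),
    main _ (fun q => u q + u (bQ q)) _ _ hN1 hQ1 (fun h => ?_) (fun _ => by simp [hu]),
    main _ (fun q => u q + (2 : ℕ) • u (bQ q)) _ _ hN2 hQ2 (fun h => ?_) (fun _ => by simp [hu])⟩
  · nth_rewrite 1 [hdec h]
    simp only [map_add]; abel
  · nth_rewrite 1 [hdec h]
    simp only [map_add, map_nsmul, nsmul_add]; abel

theorem of_equiv {H G : Type*} [AddCommGroup H] [AddCommGroup G] (e : H ≃+ G)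
    (hH : HasStrongCompleteMapping H) : HasStrongCompleteMapping G := by
  obtain ⟨b, h0, h1, h2⟩ := hH
  refine ⟨fun g => e (b (e.symm g)), ?_, ?_, ?_⟩
  · exact e.injective.comp (h0.comp e.symm.injective)
  · intro g g' h
    apply e.symm.injective
    apply h1
    apply e.injective
    simpa using h
  · intro g g' h
    apply e.symm.injective
    apply h2
    apply e.injective
    simpa using h

/-- With the mapping b chosen below, h + 2 • b h is (0, 3i) or (1, 3i + 2), hence the condition on
3, while h + b h is (t i, 2i) or (t (i + 1), 2i + 1): parity separates the two cases and t repairs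
the two-to-one doubling. -/
theorem two_times_zmod {q : ℕ} (hq : 1 ≤ q)
    (h3 : ∀ x : ZMod (2 * q), (3 : ZMod (2 * q)) * x = 0 → x = 0) :
    HasStrongCompleteMapping (ZMod 2 × ZMod (2 * q)) := by
  have : NeZero (2 * q) := ⟨by omega⟩
  -- `t` tells the two halves of the cycle apart; doubling identifies i with i + q, which lie in
  -- different halves.
  let t : ZMod (2 * q) → ZMod 2 := fun i => if i.val < q then 0 else 1
  have key : ∀ i j : ZMod (2 * q), t i = t j → 2 * i = 2 * j → i = j := by
    intro i j ht h2
    have hi := ZMod.val_lt i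
    have hj := ZMod.val_lt j
    have h3 : ((2 * i.val : ℕ) : ZMod (2 * q)) = ((2 * j.val : ℕ) : ZMod (2 * q)) := by
      push_cast [ZMod.natCast_zmod_val]; exact h2
    rw [ZMod.natCast_eq_natCast_iff] at h3
    have h4 : i.val ≡ j.val [MOD q] := Nat.ModEq.mul_left_cancel' (by norm_num) h3
    apply ZMod.val_injective
    by_cases hiq : i.val < q <;> by_cases hjq : j.val < q <;> simp [t, hiq, hjq] at ht
    · exact h4.eq_of_lt_of_lt hiq hjq
    · have h5 : i.val - q ≡ j.val - q [MOD q] := by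
        apply Nat.ModEq.add_right_cancel' q
        rwa [Nat.sub_add_cancel (by omega), Nat.sub_add_cancel (by omega)]
      have := h5.eq_of_lt_of_lt (by omega) (by omega)
      omega
  have par : ∀ i j : ZMod (2 * q), 2 * i ≠ 2 * j + 1 := by
    intro i j h
    have := congrArg (ZMod.castHom (dvd_mul_right 2 q) (ZMod 2)) h
    simp only [map_mul, map_add, map_one, map_ofNat] at this
    generalize ZMod.castHom (dvd_mul_right 2 q) (ZMod 2) i = a at this
    generalize ZMod.castHom (dvd_mul_right 2 q) (ZMod 2) j = b at this
    revert a b; decide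
  have z2 : ∀ x : ZMod 2, x = 0 ∨ x = 1 := by decide
  have two : (2 : ZMod 2) = 0 := rfl
  refine ⟨fun h => if h.1 = 0 then (t h.2, h.2) else (1 + t (h.2 + 1), h.2 + 1), ?_, ?_, ?_⟩
  · rintro ⟨x, i⟩ ⟨y, j⟩ h
    rcases z2 x with rfl | rfl <;> rcases z2 y with rfl | rfl <;> simp at h ⊢
    · exact h.2
    · obtain ⟨h1, rfl⟩ := h; simp at h1
    · obtain ⟨h1, rfl⟩ := h; simp at h1
    · exact h.2
  · rintro ⟨x, i⟩ ⟨y, j⟩ h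
    rcases z2 x with rfl | rfl <;> rcases z2 y with rfl | rfl <;> simp at h ⊢
    · exact key _ _ h.1 (by linear_combination h.2)
    · exact par i j (by linear_combination h.2)
    · exact par j i (by linear_combination -h.2)
    · exact add_right_cancel (key _ _ h.1 (by linear_combination h.2))
  · rintro ⟨x, i⟩ ⟨y, j⟩ h
    rcases z2 x with rfl | rfl <;> rcases z2 y with rfl | rfl <;>
      simp [two] at h ⊢
    · exact sub_eq_zero.mp (h3 _ (by linear_combination h))
    · exact sub_eq_zero.mp (h3 _ (by linear_combination h))

/-- A linear b with b and 1 + b invertible is enough here, since 2 • b = 0. This case is a base of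
its own: splitting off one ZMod 2 × ZMod 2 would leave a cyclic factor. -/
theorem zmod_two_cube : HasStrongCompleteMapping (ZMod 2 × ZMod 2 × ZMod 2) :=
  ⟨fun x => (x.2.2, x.1 + x.2.2, x.2.1), by decide, by decide, by decide⟩

theorem two_times_two_pow (a : ℕ) :
    HasStrongCompleteMapping (ZMod 2 × ZMod (2 ^ (a + 1))) := by
  have e : 2 ^ (a + 1) = 2 * 2 ^ a := by ring
  rw [e]
  refine two_times_zmod Nat.one_le_two_pow fun x hx => ?_
  have hu : IsUnit ((3 : ℕ) : ZMod (2 * 2 ^ a)) := by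
    rw [ZMod.isUnit_iff_coprime, ← e]
    exact Nat.Coprime.pow_right _ (by norm_num)
  exact (hu.mul_right_eq_zero).mp (by exact_mod_cast hx)

end HasStrongCompleteMapping

/-! ### The exact sequence given by doubling and parity. -/

/-- Multiplication by two, from `ZMod (2 ^ a)` to `ZMod (2 ^ (a + 1))`. -/
def zmodDouble (a : ℕ) : ZMod (2 ^ a) →+ ZMod (2 ^ (a + 1)) :=
  ZMod.lift (2 ^ a) ⟨zmultiplesHom _ 2, by
    have := ZMod.natCast_self (2 ^ (a + 1))
    push_cast at this
    simp [← this, pow_succ]⟩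

/-- Reduction modulo two. -/
def zmodParity (a : ℕ) : ZMod (2 ^ (a + 1)) →+ ZMod 2 :=
  (ZMod.castHom (dvd_pow_self 2 (Nat.succ_ne_zero a)) (ZMod 2)).toAddMonoidHom

theorem zmodDouble_intCast (a : ℕ) (n : ℤ) : zmodDouble a n = ((2 * n : ℤ) : ZMod (2 ^ (a + 1))) := by
  rw [zmodDouble, ZMod.lift_coe]
  simp [mul_comm]

theorem zmodParity_intCast (a : ℕ) (n : ℤ) : zmodParity a n = (n : ZMod 2) := by
  simp [zmodParity]

theorem zmodDouble_injective (a : ℕ) : Function.Injective (zmodDouble a) := by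
  rw [injective_iff_map_eq_zero]
  intro x hx
  obtain ⟨n, rfl⟩ := ZMod.intCast_surjective x
  rw [zmodDouble_intCast, ZMod.intCast_zmod_eq_zero_iff_dvd] at hx
  rw [ZMod.intCast_zmod_eq_zero_iff_dvd]
  push_cast [pow_succ] at hx ⊢
  rw [mul_comm] at hx
  exact (mul_dvd_mul_iff_left (by norm_num)).mp hx

theorem zmodParity_double (a : ℕ) (x : ZMod (2 ^ a)) : zmodParity a (zmodDouble a x) = 0 := by
  obtain ⟨n, rfl⟩ := ZMod.intCast_surjective x
  rw [zmodDouble_intCast, zmodParity_intCast, ZMod.intCast_zmod_eq_zero_iff_dvd]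
  simp

theorem exists_zmodDouble_eq (a : ℕ) (x : ZMod (2 ^ (a + 1))) (hx : zmodParity a x = 0) :
    ∃ y, zmodDouble a y = x := by
  obtain ⟨n, rfl⟩ := ZMod.intCast_surjective x
  rw [zmodParity_intCast, ZMod.intCast_zmod_eq_zero_iff_dvd] at hx
  obtain ⟨m, rfl⟩ := hx
  exact ⟨m, zmodDouble_intCast a m⟩

theorem zmodParity_surjective (a : ℕ) : Function.Surjective (zmodParity a) := fun x =>
  ⟨((x.val : ℤ) : ZMod (2 ^ (a + 1))), by rw [zmodParity_intCast]; simp⟩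

/-! ### Strong complete mappings on noncyclic abelian 2-groups. -/

namespace HasStrongCompleteMapping

/-- Doubling in both factors embeds the product with both exponents lowered by one, with quotient
ZMod 2 × ZMod 2. -/
theorem two_pow_prod_two_pow (a : ℕ) : ∀ b : ℕ,
    HasStrongCompleteMapping (ZMod (2 ^ (a + 1)) × ZMod (2 ^ (b + 1))) := by
  induction a with
  | zero => exact fun b => two_times_two_pow b
  | succ a ih =>
    rintro (_ | b)
    · exact of_equiv AddEquiv.prodComm (two_times_two_pow (a + 1))
    · refine of_exact ((zmodDouble (a + 1)).prodMap (zmodDouble (b + 1)))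
        ((zmodParity (a + 1)).prodMap (zmodParity (b + 1)))
        ((zmodDouble_injective _).prodMap (zmodDouble_injective _))
        ((zmodParity_surjective _).prodMap (zmodParity_surjective _)) ?_ ?_ (ih b)
        (two_times_two_pow 0)
      · intro n
        exact Prod.ext (zmodParity_double _ _) (zmodParity_double _ _)
      · rintro ⟨x, y⟩ h
        simp only [AddMonoidHom.coe_prodMap, Prod.map_apply, Prod.mk_eq_zero] at h
        obtain ⟨u, hu⟩ := exists_zmodDouble_eq _ _ h.1
        obtain ⟨v, hv⟩ := exists_zmodDouble_eq _ _ h.2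
        exact ⟨(u, v), by simp [hu, hv]⟩

/-- A factor of order at least 4 can be shared: its even part goes with the second factor into the
kernel, its parity with the third into the quotient, and neither piece is cyclic. -/
theorem three_two_pow_aux (a b c : ℕ) : HasStrongCompleteMapping
    (ZMod (2 ^ (a + 2)) × ZMod (2 ^ (b + 1)) × ZMod (2 ^ (c + 1))) := by
  refine of_exact (N := ZMod (2 ^ (a + 1)) × ZMod (2 ^ (b + 1)))
    (Q := ZMod 2 × ZMod (2 ^ (c + 1)))
    ((zmodDouble (a + 1)).prodMap (AddMonoidHom.inl _ _))
    ((zmodParity (a + 1)).prodMap (AddMonoidHom.snd _ _))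
    ((zmodDouble_injective (a + 1)).prodMap
      (g := AddMonoidHom.inl (ZMod (2 ^ (b + 1))) (ZMod (2 ^ (c + 1))))
      fun _ _ h => congrArg Prod.fst h)
    ((zmodParity_surjective _).prodMap Prod.snd_surjective) ?_ ?_
    (two_pow_prod_two_pow a b) (two_times_two_pow c)
  · intro n
    exact Prod.ext (zmodParity_double _ _) rfl
  · rintro ⟨x, y, z⟩ h
    simp only [AddMonoidHom.coe_prodMap, Prod.map_apply, Prod.mk_eq_zero] at h
    obtain ⟨u, hu⟩ := exists_zmodDouble_eq _ _ h.1
    exact ⟨(u, y), by simpa [hu] using h.2.symm⟩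

theorem three_two_pow (a b c : ℕ) : HasStrongCompleteMapping
    (ZMod (2 ^ (a + 1)) × ZMod (2 ^ (b + 1)) × ZMod (2 ^ (c + 1))) := by
  rcases a with _ | a
  · rcases b with _ | b
    · rcases c with _ | c
      · exact zmod_two_cube
      · exact of_equiv (AddEquiv.prodComm.trans AddEquiv.prodAssoc) (three_two_pow_aux c 0 0)
    · exact of_equiv (AddEquiv.prodComm.trans AddEquiv.prodAssoc) (of_equiv
        (AddEquiv.prodComm.trans AddEquiv.prodAssoc) (three_two_pow_aux b c 0))
  · exact three_two_pow_aux a b c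

/-- Factors are split off two at a time, so that no single cyclic factor is left over; hence the
base cases of two and three factors. -/
theorem pi_two_pow : ∀ (k : ℕ) (e : Fin (k + 2) → ℕ),
    HasStrongCompleteMapping (∀ i, ZMod (2 ^ (e i + 1)))
  | 0, e => by
    refine of_equiv (H := ZMod (2 ^ (e 0 + 1)) × ZMod (2 ^ (e 1 + 1)))
      { (piFinTwoEquiv fun i => ZMod (2 ^ (e i + 1))).symm with
        map_add' := fun x y => by ext i; fin_cases i <;> rfl } (two_pow_prod_two_pow _ _)
  | 1, e => by
    refine of_equiv (H := ZMod (2 ^ (e 0 + 1)) × ZMod (2 ^ (e 1 + 1)) × ZMod (2 ^ (e 2 + 1)))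
      { toFun := fun x => Fin.cons x.1 (Fin.cons x.2.1 (Fin.cons x.2.2 finZeroElim))
        invFun := fun f => (f 0, f 1, f 2)
        left_inv := fun x => rfl
        right_inv := fun f => by ext i; fin_cases i <;> rfl
        map_add' := fun x y => by ext i; fin_cases i <;> rfl } (three_two_pow _ _ _)
  | k + 2, e => by
    refine of_exact (N := ZMod (2 ^ (e 0 + 1)) × ZMod (2 ^ (e 1 + 1)))
      (Q := ∀ i : Fin (k + 2), ZMod (2 ^ (e i.succ.succ + 1)))
      { toFun := fun x => Fin.cons x.1 (Fin.cons x.2 0)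
        map_zero' := by
          ext i; refine Fin.cases ?_ (fun i => Fin.cases ?_ (fun i => ?_) i) i <;> rfl
        map_add' := fun x y => by
          ext i; refine Fin.cases ?_ (fun i => Fin.cases ?_ (fun i => ?_) i) i <;> simp <;>
            first | rfl | exact (add_zero _).symm }
      { toFun := fun f i => f i.succ.succ
        map_zero' := rfl
        map_add' := fun _ _ => rfl } ?_ ?_ ?_ ?_ (two_pow_prod_two_pow _ _) (pi_two_pow k _)
    · intro x y h
      exact Prod.ext (congrFun h 0) (congrFun h 1)
    · intro f
      exact ⟨Fin.cons 0 (Fin.cons 0 f), rfl⟩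
    · intro n; rfl
    · intro f hf
      refine ⟨(f 0, f 1), ?_⟩
      ext i
      refine Fin.cases ?_ (fun i => Fin.cases ?_ (fun i => ?_) i) i
      · rfl
      · rfl
      · exact (congrFun hf i).symm

/-- A finite abelian `2`-group with two involutions has a strong complete mapping. -/
theorem of_two_involutions {H : Type*} [AddCommGroup H] {α : ℕ} (hH : Nat.card H = 2 ^ α)
    {x y : H} (hx : x ≠ 0) (hy : y ≠ 0) (hxy : x ≠ y) (hx2 : x + x = 0) (hy2 : y + y = 0) :
    HasStrongCompleteMapping H := by
  have : Finite H := Nat.finite_of_card_ne_zero (by rw [hH]; positivity)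
  classical
  obtain ⟨ι, _, n, hn, ⟨e⟩⟩ := AddCommGroup.equiv_directSum_zmod_of_finite' H
  replace e := e.trans (DirectSum.addEquivProd fun i => ZMod (n i))
  have hcard : ∏ i, n i = 2 ^ α := by
    rw [← hH, Nat.card_congr e.toEquiv, Nat.card_pi]
    simp
  have hpow : ∀ i, ∃ a, n i = 2 ^ (a + 1) := fun i => by
    have : n i ∣ 2 ^ α := hcard ▸ Finset.dvd_prod_of_mem n (Finset.mem_univ i)
    obtain ⟨a, -, ha⟩ := (Nat.dvd_prime_pow Nat.prime_two).mp this
    rcases a with _ | a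
    · have := hn i; simp [ha] at this
    · exact ⟨a, ha⟩
  choose a ha using hpow
  -- A cyclic group has at most one involution, so two involutions force at least two cyclic
  -- factors.
  have hinv : ∀ i (u v : ZMod (n i)), u ≠ 0 → v ≠ 0 → u + u = 0 → v + v = 0 → u = v := by
    intro i
    have : NeZero (n i) := ⟨by have := hn i; omega⟩
    have key : ∀ u : ZMod (n i), u ≠ 0 → u + u = 0 → 2 * u.val = n i := by
      intro u hu hu2
      have h1 : ((u.val + u.val : ℕ) : ZMod (n i)) = 0 := by
        push_cast [ZMod.natCast_zmod_val]; exact hu2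
      rw [ZMod.natCast_eq_zero_iff] at h1
      obtain ⟨k, hk⟩ := h1
      have h2 := ZMod.val_lt u
      have h3 : u.val ≠ 0 := by simpa using hu
      have : k = 1 := by
        have : k < 2 := by
          by_contra! hk2
          have := Nat.mul_le_mul_left (n i) hk2
          omega
        interval_cases k <;> omega
      subst this; omega
    intro u v hu hv hu2 hv2
    apply ZMod.val_injective
    have := key u hu hu2
    have := key v hv hv2
    omega
  have hι : 2 ≤ Fintype.card ι := by
    by_contra! hlt
    have : Subsingleton ι := Fintype.card_le_one_iff_subsingleton.mp (by omega)
    have hne : ∀ z : H, z ≠ 0 → ∃ i, e z i ≠ 0 := fun z hz => by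
      by_contra! h
      exact hz (e.injective (by rw [map_zero]; exact funext h))
    obtain ⟨i, hi⟩ := hne x hx
    obtain ⟨j, hj⟩ := hne y hy
    obtain rfl := Subsingleton.elim i j
    apply hxy
    apply e.injective
    ext j
    obtain rfl := Subsingleton.elim i j
    exact hinv i _ _ hi hj (by rw [← Pi.add_apply, ← map_add, hx2, map_zero]; rfl)
      (by rw [← Pi.add_apply, ← map_add, hy2, map_zero]; rfl)
  obtain ⟨k, hk⟩ := Nat.exists_eq_add_of_le hι
  obtain rfl : n = fun i => 2 ^ (a i + 1) := funext ha
  let σ : Fin (k + 2) ≃ ι := (finCongr (by omega)).trans (Fintype.equivFin ι).symm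
  refine of_equiv ?_ (pi_two_pow k fun i => a (σ i))
  exact AddEquiv.trans
    { Equiv.piCongrLeft (fun i => ZMod (2 ^ (a i + 1))) σ with
      map_add' := fun f g => by
        ext i
        obtain ⟨j, rfl⟩ := σ.surjective i
        simp only [Equiv.toFun_as_coe, Pi.add_apply, Equiv.piCongrLeft_apply_apply] } e.symm

end HasStrongCompleteMapping

/-! ### Subgroups of given order, sign functions and zero-sum subsets. -/

/-- A finite abelian group has a subgroup of every order that divides its own. -/
theorem exists_addSubgroup_card_eq (d : ℕ) : ∀ {G : Type*} [AddCommGroup G] [Finite G],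
    d ∣ Nat.card G → ∃ S : AddSubgroup G, Nat.card S = d := by
  induction d using Nat.strong_induction_on with
  | _ d ih =>
    intro G _ _ hd
    rcases eq_or_ne d 1 with rfl | h1
    · exact ⟨⊥, AddSubgroup.card_bot⟩
    have hd0 : d ≠ 0 := fun h => Nat.card_pos.ne' (Nat.eq_zero_of_zero_dvd (h ▸ hd))
    have hp := Nat.minFac_prime h1
    have : Fact d.minFac.Prime := ⟨hp⟩
    obtain ⟨x, hx⟩ := exists_prime_addOrderOf_dvd_card' (G := G) d.minFac
      ((Nat.minFac_dvd d).trans hd)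
    obtain ⟨e, he⟩ := Nat.minFac_dvd d
    have hZ : Nat.card (AddSubgroup.zmultiples x) = d.minFac := by
      rw [Nat.card_zmultiples, hx]
    have hG := AddSubgroup.card_eq_card_quotient_mul_card_addSubgroup (AddSubgroup.zmultiples x)
    have he0 : 0 < e := Nat.pos_of_ne_zero (by rintro rfl; exact hd0 (by simpa using he))
    -- Induction in the quotient by a subgroup of prime order; the preimage of S has order d.
    obtain ⟨S, hS⟩ := ih e (by
        conv_rhs => rw [he]
        exact lt_mul_of_one_lt_left he0 hp.one_lt)
      (G := G ⧸ AddSubgroup.zmultiples x) (by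
        rw [hG, hZ] at hd
        nth_rewrite 1 [he] at hd
        rw [mul_comm] at hd
        exact Nat.dvd_of_mul_dvd_mul_right hp.pos hd)
    refine ⟨S.comap (QuotientAddGroup.mk' _), ?_⟩
    have h2 := AddSubgroup.card_mul_index (S.comap (QuotientAddGroup.mk' (AddSubgroup.zmultiples x)))
    rw [AddSubgroup.index_comap_of_surjective _ (QuotientAddGroup.mk'_surjective _), hG, hZ,
      ← AddSubgroup.card_mul_index S, hS] at h2
    have h3 : 0 < S.index := Nat.pos_of_ne_zero AddSubgroup.index_ne_zero_of_finite
    refine Nat.eq_of_mul_eq_mul_right h3 (h2.trans ?_)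
    conv_rhs => rw [he]
    ring

/-- An integer prime to the order of a finite group acts injectively. -/
theorem eq_zero_of_zsmul_eq_zero {G : Type*} [AddCommGroup G] [Finite G] {n : ℤ}
    (hn : IsCoprime n (Nat.card G)) {x : G} (hx : n • x = 0) : x = 0 := by
  obtain ⟨a, b, hab⟩ := hn
  rw [← one_zsmul x, ← hab, add_zsmul, mul_zsmul, mul_zsmul, hx, natCast_zsmul, card_nsmul_eq_zero']
  simp

theorem eq_zero_of_add_self_eq_zero {G : Type*} [AddCommGroup G] [Finite G]
    (hG : Odd (Nat.card G)) {x : G} (hx : x + x = 0) : x = 0 := by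
  refine eq_zero_of_zsmul_eq_zero (n := 2) ?_ (by rwa [two_zsmul])
  exact_mod_cast Nat.isCoprime_iff_coprime.mpr (Nat.coprime_two_left.mpr hG)

/-- A group of even order has a balanced sign function invariant under negation. -/
theorem exists_balanced_even_sign {H : Type*} [AddCommGroup H] [Fintype H]
    (hH : Even (Fintype.card H)) :
    ∃ χ : H → ℤ, (∀ h, χ h = 1 ∨ χ h = -1) ∧ (∀ h, χ (-h) = χ h) ∧ ∑ h, χ h = 0 := by
  classical
  obtain ⟨m, hm⟩ := hH
  obtain ⟨M, hM⟩ := exists_addSubgroup_card_eq m (G := H) (by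
    rw [Nat.card_eq_fintype_card, hm]; exact ⟨2, by ring⟩)
  refine ⟨fun h => if h ∈ M then 1 else -1, fun h => ?_, fun h => by simp, ?_⟩
  · by_cases h' : h ∈ M <;> simp [h']
  · have h1 : (Finset.univ.filter (· ∈ M)).card = m := by
      rw [← hM, Nat.card_eq_fintype_card, Fintype.card_subtype]
    have h2 := Finset.card_filter_add_card_filter_not (s := (Finset.univ : Finset H)) (· ∈ M)
    rw [Finset.card_univ, hm, h1] at h2
    have h3 : (Finset.univ.filter (¬ · ∈ M)).card = m := by omega
    rw [Finset.sum_ite, Finset.sum_const, Finset.sum_const, h1, h3]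
    simp

/-- A group of order `2 * m` with `m ≥ 3` has an `m`-subset of sum zero. -/
theorem exists_half_finset_sum_eq_zero {H : Type*} [AddCommGroup H] [Fintype H] {m : ℕ}
    (hH : Fintype.card H = m + m) (hm : 3 ≤ m) :
    ∃ S : Finset H, S.card = m ∧ ∑ x ∈ S, x = 0 := by
  classical
  obtain ⟨M, hM⟩ := exists_addSubgroup_card_eq m (G := H) (by
    rw [Nat.card_eq_fintype_card, hH]; exact ⟨2, by ring⟩)
  have h1 : (Finset.univ.filter (· ∈ M)).card = m := by
    rw [← hM, Nat.card_eq_fintype_card, Fintype.card_subtype]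
  obtain ⟨q, hq⟩ : ∃ q, q ∉ M := by
    by_contra! h
    rw [Finset.filter_true_of_mem (fun x _ => h x), Finset.card_univ] at h1
    omega
  -- An index-two subgroup with 0 traded for an outside element: exchanging some x in S for x - s,
  -- where s is the sum, makes the sum zero.
  let S : Finset H := insert q ((Finset.univ.filter (· ∈ M)).erase 0)
  have hmem : ∀ x, x ∈ S ↔ x = q ∨ (x ≠ 0 ∧ x ∈ M) := fun x => by simp [S]
  have hS : S.card = m := by
    rw [Finset.card_insert_of_notMem (by simp [hq]), Finset.card_erase_of_mem (by simp), h1]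
    omega
  set s := ∑ x ∈ S, x with hs
  by_cases hs0 : s = 0
  · exact ⟨S, hS, hs0⟩
  -- Otherwise S - s ⊆ S. If s ∈ M, this fails at q; if s ∉ M, all nonzero elements of M are sent to
  -- q, and m ≥ 3 provides two of them.
  obtain ⟨x, hx, hxs⟩ : ∃ x ∈ S, x - s ∉ S := by
    by_contra! h
    by_cases hsM : s ∈ M
    · rcases (hmem _).mp (h q ((hmem q).mpr (Or.inl rfl))) with h2 | ⟨-, h2⟩
      · exact hs0 (by simpa using h2)
      · exact hq (by simpa using M.add_mem h2 hsM)
    · have h2 : ∀ x ∈ M, x ≠ 0 → x - s = q := by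
        intro x hx hx0
        rcases (hmem _).mp (h x ((hmem x).mpr (Or.inr ⟨hx0, hx⟩))) with h2 | ⟨-, h2⟩
        · exact h2
        · exact absurd (by simpa using M.sub_mem hx h2) hsM
      have h3 : 2 ≤ ((Finset.univ.filter (· ∈ M)).erase 0).card := by
        rw [Finset.card_erase_of_mem (by simp), h1]; omega
      obtain ⟨x, hx, y, hy, hxy⟩ := Finset.one_lt_card.mp h3
      simp only [Finset.mem_erase, Finset.mem_filter, Finset.mem_univ, true_and] at hx hy
      exact hxy (sub_left_injective ((h2 x hx.2 hx.1).trans (h2 y hy.2 hy.1).symm))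
  have hxs' : x - s ∉ S.erase x := fun h => hxs (Finset.mem_of_mem_erase h)
  refine ⟨insert (x - s) (S.erase x), ?_, ?_⟩
  · rw [Finset.card_insert_of_notMem hxs', Finset.card_erase_of_mem hx, hS]
    omega
  · have := Finset.add_sum_erase S (fun x => x) hx
    rw [Finset.sum_insert hxs', sub_add_eq_add_sub, this, ← hs, sub_self]

/-- A group of odd order has a sign function that is odd away from zero. -/
theorem exists_odd_sign {L : Type*} [AddCommGroup L] [Fintype L] (hL : Odd (Fintype.card L)) :
    ∃ s : L → ℤ, (∀ x, s x = 1 ∨ s x = -1) ∧ ∀ x, x ≠ 0 → s (-x) = -s x := by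
  classical
  let e := Fintype.equivFin L
  refine ⟨fun x => if e x < e (-x) then 1 else -1, fun x => ?_, fun x hx => ?_⟩
  · by_cases h : e x < e (-x) <;> simp [h]
  · have hne : e x ≠ e (-x) := fun h => hx (eq_zero_of_add_self_eq_zero
      (by rwa [Nat.card_eq_fintype_card]) (eq_neg_iff_add_eq_zero.mp (e.injective h)))
    rcases lt_or_gt_of_ne hne with h | h
    · simp [h, h.not_gt]
    · simp [h, h.not_gt]

/-! ### Zero-sum arrays for H × L. -/

/-- The elements of `Γ` can be arranged, each once, in an array with rows indexed by `ι` and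
columns indexed by `κ`, all of whose rows and columns have sum zero. -/
def HasZeroSumArray (Γ ι κ : Type*) [AddCommGroup Γ] [Fintype ι] [Fintype κ] : Prop :=
  ∃ A : ι → κ → Γ, Function.Bijective (fun p : ι × κ => A p.1 p.2) ∧
    (∀ i, ∑ j, A i j = 0) ∧ ∀ j, ∑ i, A i j = 0

namespace HasZeroSumArray

theorem congr {Γ Γ' ι ι' κ κ' : Type*} [AddCommGroup Γ] [AddCommGroup Γ'] [Fintype ι] [Fintype κ]
    [Fintype ι'] [Fintype κ'] (e : Γ ≃+ Γ') (f : ι' ≃ ι) (g : κ' ≃ κ)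
    (h : HasZeroSumArray Γ ι κ) : HasZeroSumArray Γ' ι' κ' := by
  obtain ⟨A, hA, hr, hc⟩ := h
  refine ⟨fun i j => e (A (f i) (g j)), e.bijective.comp (hA.comp (f.prodCongr g).bijective),
    fun i => ?_, fun j => ?_⟩
  · rw [← map_sum, Equiv.sum_comp g (fun j => A (f i) j), hr, map_zero]
  · rw [← map_sum, Equiv.sum_comp f (fun i => A i (g j)), hc, map_zero]

/-- A zero-sum array for the part of `H × L` lying over a symmetric subset of `L` extends to
a zero-sum array for `H × L`: each remaining pair `x, -x` gives two opposite rows. -/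
theorem of_block {H L σ κ : Type*} [AddCommGroup H] [AddCommGroup L] [Fintype H] [Fintype L]
    [Fintype σ] [Fintype κ] (hH : Even (Fintype.card H)) (hH0 : ∑ h : H, h = 0)
    (hL : Odd (Fintype.card L)) (e : κ ≃ H) (ρ : σ → L) (hρ : Function.Injective ρ)
    (h0 : ∃ r, ρ r = 0) (hneg : ∀ r, ∃ s, ρ s = -ρ r) (v : σ → κ → H) (c : σ → κ → σ)
    (hinj : ∀ r j r' j', v r j = v r' j' → c r j = c r' j' → r = r' ∧ j = j')
    (hvr : ∀ r, ∑ j, v r j = 0) (hvc : ∀ j, ∑ r, v r j = 0)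
    (hcr : ∀ r, ∑ j, ρ (c r j) = 0) (hcc : ∀ j, ∑ r, ρ (c r j) = 0) :
    HasZeroSumArray (H × L) L κ := by
  classical
  obtain ⟨χ, hχ, hχn, hχ0⟩ := exists_balanced_even_sign hH
  obtain ⟨s, hs, hsn⟩ := exists_odd_sign hL
  -- In the generic row x, the H-parts sum to ± the sum of H and the L-parts cancel because χ is
  -- balanced. Rows x and -x are opposite because s is odd.
  let g : L → κ → H × L := fun x j => (s x • e j, χ (e j) • x)
  let A : L → κ → H × L := Function.extend ρ (fun r j => (v r j, ρ (c r j))) g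
  have hA1 : ∀ r j, A (ρ r) j = (v r j, ρ (c r j)) := fun r j => by
    simp only [A]; rw [hρ.extend_apply]
  have hA2 : ∀ x j, (¬ ∃ r, ρ r = x) → A x j = g x j := fun x j hx => by
    simp only [A]; rw [Function.extend_apply' _ _ _ hx]
  have hneg' : ∀ x, (¬ ∃ r, ρ r = x) → ¬ ∃ r, ρ r = -x := by
    rintro x hx ⟨r, hr⟩
    obtain ⟨s, hs⟩ := hneg r
    exact hx ⟨s, by rw [hs, hr, neg_neg]⟩
  have hg2 : ∀ x j, (¬ ∃ r, ρ r = x) → ¬ ∃ r, ρ r = (g x j).2 := by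
    intro x j hx
    rcases hχ (e j) with h | h <;> simp only [g, h, one_zsmul, neg_zsmul]
    · exact hx
    · exact hneg' x hx
  refine ⟨A, ?_, fun x => ?_, fun j => ?_⟩
  · refine Function.Injective.bijective_of_nat_card_le ?_ ?_
    · rintro ⟨x, j⟩ ⟨y, k⟩ h
      simp only at h
      by_cases hx : ∃ r, ρ r = x <;> by_cases hy : ∃ r, ρ r = y
      · obtain ⟨r, rfl⟩ := hx
        obtain ⟨t, rfl⟩ := hy
        rw [hA1, hA1, Prod.mk.injEq] at h
        obtain ⟨rfl, rfl⟩ := hinj _ _ _ _ h.1 (hρ h.2)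
        rfl
      · obtain ⟨r, rfl⟩ := hx
        rw [hA1, hA2 y k hy] at h
        exact absurd ⟨_, congrArg Prod.snd h⟩ (hg2 y k hy)
      · obtain ⟨r, rfl⟩ := hy
        rw [hA1, hA2 x j hx] at h
        exact absurd ⟨_, (congrArg Prod.snd h).symm⟩ (hg2 x j hx)
      · rw [hA2 x j hx, hA2 y k hy] at h
        simp only [g, Prod.mk.injEq] at h
        obtain ⟨h1, h2⟩ := h
        -- Since χ is even, it can be read off the H-part of an entry; the L-part then gives x, and
        -- x gives the column.
        have hχe : ∀ x j, χ (s x • e j) = χ (e j) := fun x j => by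
          rcases hs x with h | h <;> simp [h, hχn]
        have h3 : χ (e j) = χ (e k) := by rw [← hχe x j, h1, hχe]
        have h4 : x = y := by
          rw [h3] at h2
          rcases hχ (e k) with h | h <;> simpa [h] using h2
        subst h4
        have h5 : e j = e k := by rcases hs x with h | h <;> simpa [h] using h1
        rw [e.injective h5]
    · rw [Nat.card_prod, Nat.card_prod, Nat.card_congr e, mul_comm]
  · by_cases hx : ∃ r, ρ r = x
    · obtain ⟨r, rfl⟩ := hx
      simp only [hA1]
      exact Prod.ext (by rw [Prod.fst_sum]; exact hvr r) (by rw [Prod.snd_sum]; exact hcr r)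
    · simp only [hA2 x _ hx, g]
      refine Prod.ext ?_ ?_
      · rw [Prod.fst_sum, ← Finset.smul_sum, Equiv.sum_comp e (fun h => h), hH0]
        simp
      · rw [Prod.snd_sum, ← Finset.sum_smul, Equiv.sum_comp e χ, hχ0]
        simp
  · rw [← Finset.sum_filter_add_sum_filter_not Finset.univ (fun x => ∃ r, ρ r = x)]
    have h1 : ∑ x with ∃ r, ρ r = x, A x j = 0 := by
      have : (Finset.univ.filter fun x => ∃ r, ρ r = x) = Finset.univ.map ⟨ρ, hρ⟩ := by
        ext; simp
      rw [this, Finset.sum_map]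
      simp only [Function.Embedding.coeFn_mk, hA1]
      exact Prod.ext (by rw [Prod.fst_sum]; exact hvc j) (by rw [Prod.snd_sum]; exact hcc j)
    rw [h1, zero_add]
    refine Finset.sum_involution (fun x _ => -x) ?_ ?_ ?_ ?_
    · intro x hx
      simp only [Finset.mem_filter, Finset.mem_univ, true_and] at hx
      have hx0 : x ≠ 0 := by rintro rfl; exact hx h0
      rw [hA2 x j hx, hA2 (-x) j (hneg' x hx)]
      simp [g, hsn x hx0]
    · intro x hx _ h
      simp only [Finset.mem_filter, Finset.mem_univ, true_and] at hx
      have hx0 : x ≠ 0 := by rintro rfl; exact hx h0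
      exact hx0 (eq_zero_of_add_self_eq_zero (by rwa [Nat.card_eq_fintype_card])
        (neg_eq_iff_add_eq_zero.mp h))
    · intro x hx
      simp only [Finset.mem_filter, Finset.mem_univ, true_and] at hx ⊢
      exact hneg' x hx
    · intro x hx
      exact neg_neg x

/-- Swapping rows k and -k in column h changes the H-sum of row k by -(h + 2 • b h). As this
expression permutes H, a zero-sum half of H pulls back to a set J of columns whose swap keeps the
H-sums zero and balances k against -k. -/
theorem of_strongCompleteMapping {H L : Type*} [AddCommGroup H] [AddCommGroup L] [Fintype H]
    [Fintype L] {m : ℕ} (hH : Fintype.card H = m + m) (hm : 3 ≤ m)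
    (hb : HasStrongCompleteMapping H) (hL : Odd (Fintype.card L)) (hL1 : 1 < Fintype.card L) :
    HasZeroSumArray (H × L) L H := by
  classical
  obtain ⟨b, hb0, hb1, hb2⟩ := hb
  obtain ⟨S, hS, hS0⟩ := exists_half_finset_sum_eq_zero hH hm
  have : Nontrivial L := Fintype.one_lt_card_iff_nontrivial.mp hL1
  obtain ⟨k, hk⟩ := exists_ne (0 : L)
  have hkn : k ≠ -k := fun h => hk (eq_zero_of_add_self_eq_zero
    (by rwa [Nat.card_eq_fintype_card]) (eq_neg_iff_add_eq_zero.mp h))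
  have hsum : ∀ f : H → H, Function.Injective f → ∑ h, f h = ∑ h, h := fun f hf =>
    (Function.Bijective.sum_comp (Finite.injective_iff_bijective.mp hf) (fun h => h))
  -- Summing h + b h over H gives the sum of H on one side and twice it on the other.
  have hH0 : ∑ h : H, h = 0 := by
    have h1 := hsum _ hb1
    rw [Finset.sum_add_distrib, hsum _ hb0] at h1
    simpa using h1
  have hbij := Finite.injective_iff_bijective.mp hb2
  let f : H ≃ H := Equiv.ofBijective _ hbij
  let J : Finset H := S.map f.symm.toEmbedding
  have hJ : J.card = m := by rw [Finset.card_map, hS]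
  have hJ0 : ∑ h ∈ J, (h + (2 : ℕ) • b h) = 0 := by
    rw [Finset.sum_map, ← hS0]
    exact Finset.sum_congr rfl fun x _ => f.apply_symm_apply x
  have hJc : (Finset.univ.filter (· ∉ J)).card = m := by
    have h2 := Finset.card_filter_add_card_filter_not (s := (Finset.univ : Finset H)) (· ∈ J)
    rw [Finset.card_univ, hH, Finset.filter_mem_eq_inter, Finset.univ_inter, hJ] at h2
    omega
  have hbs : ∑ h, b h = 0 := (hsum _ hb0).trans hH0
  -- `v` holds the H-parts, and `c` the indices of the L-parts in (0, k, -k).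
  let v : Fin 3 → H → H := ![fun h => h, fun h => if h ∈ J then -h - b h else b h,
    fun h => if h ∈ J then b h else -h - b h]
  let c : Fin 3 → H → Fin 3 := ![fun _ => 0, fun h => if h ∈ J then 2 else 1,
    fun h => if h ∈ J then 1 else 2]
  have hv1 : ∑ h, v 1 h = 0 := by
    have : ∀ h, v 1 h = b h - if h ∈ J then h + (2 : ℕ) • b h else 0 := fun h => by
      by_cases hh : h ∈ J <;> simp [v, hh]
      rw [two_nsmul]; abel
    rw [Finset.sum_congr rfl fun h _ => this h, Finset.sum_sub_distrib, hbs,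
      ← Finset.sum_filter, Finset.filter_mem_eq_inter, Finset.univ_inter, hJ0, sub_zero]
  have hcol : ∀ j, ∑ r, v r j = 0 := fun j => by
    rw [Fin.sum_univ_three]
    by_cases hh : j ∈ J <;> simp [v, hh]
    abel
  have hc1 : ∀ h, (![0, k, -k] : Fin 3 → L) (c 1 h) = if h ∈ J then -k else k := fun h => by
    by_cases hh : h ∈ J <;> simp [c, hh]
  have hc2 : ∀ h, (![0, k, -k] : Fin 3 → L) (c 2 h) = if h ∈ J then k else -k := fun h => by
    by_cases hh : h ∈ J <;> simp [c, hh]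
  refine of_block ⟨m, hH⟩ hH0 hL (Equiv.refl H) ![0, k, -k] ?_ ⟨0, rfl⟩ ?_ v c ?_ ?_ hcol ?_ ?_
  · intro r s h
    fin_cases r <;> fin_cases s <;> simp_all [eq_comm]
  · intro r
    fin_cases r
    · exact ⟨0, by simp⟩
    · exact ⟨2, by simp⟩
    · exact ⟨1, by simp⟩
  · have hc1 : ∀ h h', -h - b h = -h' - b h' → h = h' := fun h h' e => hb1 (by
      have := congrArg Neg.neg e
      simpa [add_comm] using this)
    intro r j r' j' h1 h2
    fin_cases r <;> fin_cases r' <;> by_cases hj : j ∈ J <;> by_cases hj' : j' ∈ J <;>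
      simp [v, c, hj, hj'] at h1 h2 ⊢
    all_goals first
      | exact h1
      | exact hb0 h1
      | exact hc1 _ _ h1
      | (rw [hb0 h1] at hj; exact hj hj')
      | (rw [hb0 h1] at hj; exact hj' hj)
      | (rw [hc1 _ _ h1] at hj; exact hj hj')
      | (rw [hc1 _ _ h1] at hj; exact hj' hj)
  · intro r
    fin_cases r
    · exact hH0
    · exact hv1
    · have h1 : ∑ r, ∑ h, v r h = 0 := by
        rw [Finset.sum_comm]; exact Finset.sum_eq_zero fun j _ => hcol j
      rw [Fin.sum_univ_three, hv1, show ∑ h, v 0 h = 0 from hH0] at h1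
      simpa using h1
  · intro r
    fin_cases r
    · simp [c]
    · refine (Finset.sum_congr rfl fun h _ => hc1 h).trans ?_
      simp [Finset.sum_ite, hJ, hJc]
    · refine (Finset.sum_congr rfl fun h _ => hc2 h).trans ?_
      simp [Finset.sum_ite, hJ, hJc]
  · intro j
    rw [Fin.sum_univ_three]
    by_cases hh : j ∈ J <;> simp [c, hh]

/-- Two distinct elements of the Klein group never sum to zero, so the swapping argument is
unavailable, and ZMod 3 has no second pair ±l; an explicit array is given. -/
theorem klein_prod_zmod_three :
    HasZeroSumArray ((ZMod 2 × ZMod 2) × ZMod 3) (Fin 3) (Fin 4) := by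
  refine ⟨![![((1, 0), 0), ((1, 1), 2), ((0, 1), 1), ((0, 0), 0)],
    ![((1, 1), 1), ((0, 0), 1), ((0, 1), 0), ((1, 0), 1)],
    ![((0, 1), 2), ((1, 1), 0), ((0, 0), 2), ((1, 0), 2)]], ?_, by decide, by decide⟩
  refine Function.Injective.bijective_of_nat_card_le ?_ (by simp)
  decide

/-- A second pair ±l gives room for an explicit block of five rows, to which `of_block` applies. -/
theorem klein_prod {L : Type*} [AddCommGroup L] [Fintype L] (hL : Odd (Fintype.card L))
    (hL3 : 3 < Fintype.card L) : HasZeroSumArray ((ZMod 2 × ZMod 2) × L) L (Fin 4) := by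
  classical
  have : Nontrivial L := Fintype.one_lt_card_iff_nontrivial.mp (by omega)
  obtain ⟨k, hk⟩ := exists_ne (0 : L)
  obtain ⟨l, hl⟩ : ∃ l, l ∉ ({0, k, -k} : Finset L) := by
    by_contra! h
    have h1 : Finset.univ.card ≤ ({0, k, -k} : Finset L).card :=
      Finset.card_le_card fun x _ => h x
    have h2 := Finset.card_le_three (a := (0 : L)) (b := k) (c := -k)
    rw [Finset.card_univ] at h1
    omega
  simp only [Finset.mem_insert, Finset.mem_singleton, not_or] at hl
  obtain ⟨hl0, hlk, hlk'⟩ := hl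
  have hkl' : -l ≠ k := fun h => hlk' (by rw [← h, neg_neg])
  have hn : ∀ x : L, x ≠ 0 → x ≠ -x := fun x hx h => hx (eq_zero_of_add_self_eq_zero
    (by rwa [Nat.card_eq_fintype_card]) (eq_neg_iff_add_eq_zero.mp h))
  have hkn := hn k hk
  have hln := hn l hl0
  -- The first matrix lists the H-parts, the second the indices of the L-parts in (0, k, -k, l, -l).
  refine of_block (σ := Fin 5) (by decide) (by decide) hL
    (Fintype.equivOfCardEq (by simp)) ![0, k, -k, l, -l] ?_ ⟨0, rfl⟩ ?_
    ![![(0, 0), (1, 0), (0, 1), (1, 1)], ![(0, 0), (1, 1), (1, 0), (0, 1)],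
      ![(0, 0), (1, 1), (0, 1), (1, 0)], ![(0, 1), (0, 0), (1, 0), (1, 1)],
      ![(0, 1), (1, 0), (0, 0), (1, 1)]]
    ![![0, 0, 0, 0], ![2, 2, 1, 1], ![1, 1, 2, 2], ![4, 3, 3, 4], ![3, 4, 4, 3]]
    (by decide) (by decide) (by decide) ?_ ?_
  · intro r s h
    fin_cases r <;> fin_cases s <;> simp_all [eq_comm]
  · intro r
    fin_cases r
    · exact ⟨0, by simp⟩
    · exact ⟨2, by simp⟩
    · exact ⟨1, by simp⟩
    · exact ⟨4, by simp⟩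
    · exact ⟨3, by simp⟩
  · intro r
    rw [Fin.sum_univ_four]
    fin_cases r <;> simp
  · intro j
    rw [Fin.sum_univ_five]
    fin_cases j <;> simp

end HasZeroSumArray

/-! ### Lifting arrays through a quotient of odd kernel. -/

/-- An array whose row and column sums lie in a subgroup can be moved, within the cosets of its
entries, to an array whose row and column sums vanish. -/
theorem exists_sub_mem_and_sum_eq_zero {Γ ι κ : Type*} [AddCommGroup Γ] [Fintype ι] [Fintype κ]
    [Nonempty ι] [Nonempty κ] (T : AddSubgroup Γ) (B : ι → κ → Γ) (hr : ∀ i, ∑ j, B i j ∈ T)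
    (hc : ∀ j, ∑ i, B i j ∈ T) :
    ∃ B' : ι → κ → Γ, (∀ i j, B' i j - B i j ∈ T) ∧ (∀ i, ∑ j, B' i j = 0) ∧
      ∀ j, ∑ i, B' i j = 0 := by
  classical
  obtain ⟨i₀⟩ := ‹Nonempty ι›
  obtain ⟨j₀⟩ := ‹Nonempty κ›
  let r : ι → Γ := fun i => ∑ j, B i j
  let s : κ → Γ := fun j => ∑ i, B i j
  have hrs : ∑ j, s j = ∑ i, r i := Finset.sum_comm
  -- Row sums are removed in column j₀ and column sums in row i₀; the corner, corrected twice, gets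
  -- the total back.
  refine ⟨fun i j => B i j - (if j = j₀ then r i else 0) - (if i = i₀ then s j else 0) +
    if i = i₀ then if j = j₀ then ∑ i, r i else 0 else 0, fun i j => ?_, fun i => ?_, fun j => ?_⟩
  · have h1 : (if j = j₀ then r i else 0) ∈ T := by
      split_ifs; exacts [hr i, T.zero_mem]
    have h2 : (if i = i₀ then s j else 0) ∈ T := by
      split_ifs; exacts [hc j, T.zero_mem]
    have h3 : (if i = i₀ then if j = j₀ then ∑ i, r i else 0 else 0) ∈ T := by
      split_ifs; exacts [T.sum_mem fun i _ => hr i, T.zero_mem, T.zero_mem]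
    have h4 := T.sub_mem (T.sub_mem h3 h1) h2
    convert h4 using 1
    beta_reduce
    abel
  · simp only [Finset.sum_add_distrib, Finset.sum_sub_distrib]
    by_cases hi : i = i₀ <;> simp [hi, hrs, r]
  · simp only [Finset.sum_add_distrib, Finset.sum_sub_distrib]
    by_cases hj : j = j₀ <;> simp [hj, s]

/-- A zero-sum array for a quotient by a subgroup of odd order lifts to a family of arrays. -/
theorem HasZeroSumArray.exists_lift {Γ Γ' ι κ : Type*} [AddCommGroup Γ] [AddCommGroup Γ'] [Finite Γ]
    [Fintype ι] [Fintype κ] [Nonempty ι] [Nonempty κ] (π : Γ →+ Γ') (hπ : Function.Surjective π)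
    (hker : Odd (Nat.card π.ker)) (g : ι → ℤ) (χ : κ → ℤ)
    (hg : ∀ i, g i = 1 ∨ g i = -1 ∨ g i = -2) (hχ : ∀ j, χ j = 1 ∨ χ j = -1)
    (hg0 : ∑ i, g i = 0) (hχ0 : ∑ j, χ j = 0) (h : HasZeroSumArray Γ' ι κ) :
    ∃ R : π.ker → ι → κ → Γ,
      Function.Bijective (fun p : π.ker × ι × κ => R p.1 p.2.1 p.2.2) ∧
      (∀ t i, ∑ j, R t i j = 0) ∧ ∀ t j, ∑ i, R t i j = 0 := by
  obtain ⟨A, hA, hAr, hAc⟩ := h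
  choose u hu using hπ
  obtain ⟨B, hB, hBr, hBc⟩ := exists_sub_mem_and_sum_eq_zero π.ker (fun i j => u (A i j))
    (fun i => by simp [AddMonoidHom.mem_ker, hu, hAr])
    (fun j => by simp [AddMonoidHom.mem_ker, hu, hAc])
  have hπB : ∀ i j, π (B i j) = A i j := fun i j => by
    have := hB i j
    rwa [AddMonoidHom.mem_ker, map_sub, hu, sub_eq_zero] at this
  have hcop : ∀ i j, IsCoprime (g i * χ j) (Nat.card π.ker : ℤ) := fun i j => by
    have h2 : IsCoprime (2 : ℤ) (Nat.card π.ker : ℤ) := by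
      exact_mod_cast Nat.isCoprime_iff_coprime.mpr (Nat.coprime_two_left.mpr hker)
    rcases hg i with h | h | h <;> rcases hχ j with h' | h' <;> rw [h, h']
    exacts [isCoprime_one_left, isCoprime_one_left.neg_left, isCoprime_one_left.neg_left,
      isCoprime_one_left, h2.neg_left, h2]
  -- The coefficients are ±1 or ±2, so they act injectively on the odd kernel and each coset is
  -- filled exactly once.
  refine ⟨fun t i j => B i j + (g i * χ j) • (t : Γ), ?_, fun t i => ?_, fun t j => ?_⟩
  · have hinj : Function.Injective
        (fun p : π.ker × ι × κ => B p.2.1 p.2.2 + (g p.2.1 * χ p.2.2) • (p.1 : Γ)) := by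
      rintro ⟨t, i, j⟩ ⟨t', i', j'⟩ e
      simp only at e
      have e1 : A i j = A i' j' := by
        have ht : π t = 0 := t.2
        have ht' : π t' = 0 := t'.2
        simpa [hπB, ht, ht'] using congrArg π e
      obtain ⟨rfl, rfl⟩ := Prod.mk.inj (hA.injective (a₁ := (i, j)) (a₂ := (i', j')) e1)
      have e2 : (g i * χ j) • (t - t') = 0 := by
        rw [zsmul_sub, sub_eq_zero]
        exact Subtype.ext (by simpa using e)
      rw [sub_eq_zero.mp (eq_zero_of_zsmul_eq_zero (hcop i j) e2)]
    refine hinj.bijective_of_nat_card_le ?_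
    rw [Nat.card_prod, Nat.card_congr (Equiv.ofBijective _ hA),
      ← AddSubgroup.card_mul_index π.ker, AddSubgroup.index_ker,
      AddMonoidHom.range_eq_top.mpr (fun x => ⟨u x, hu x⟩), AddSubgroup.card_top]
  · rw [Finset.sum_add_distrib, hBr, ← Finset.sum_smul, ← Finset.mul_sum, hχ0]
    simp
  · rw [Finset.sum_add_distrib, hBc, ← Finset.sum_smul, ← Finset.sum_mul, hg0]
    simp

/-! ### Splitting off the 2-part, and assembly. -/

/-- A finite abelian group of order `m * q`, with `m` and `q` coprime, is the product of
a group of order `m` and a group of order `q`. -/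
theorem exists_prod_addEquiv_of_coprime {G : Type*} [AddCommGroup G] [Finite G] {m q : ℕ}
    (hG : Nat.card G = m * q) (hmq : m.Coprime q) :
    ∃ H K : AddSubgroup G, Nat.card H = m ∧ Nat.card K = q ∧ Nonempty (H × K ≃+ G) := by
  obtain ⟨H, hH⟩ := exists_addSubgroup_card_eq m (G := G) (hG ▸ dvd_mul_right m q)
  obtain ⟨K, hK⟩ := exists_addSubgroup_card_eq q (G := G) (hG ▸ dvd_mul_left q m)
  refine ⟨H, K, hH, hK, ⟨AddEquiv.ofBijective (H.subtype.coprod K.subtype)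
    (Function.Injective.bijective_of_nat_card_le ?_ (by rw [Nat.card_prod, hH, hK, hG]))⟩⟩
  rw [injective_iff_map_eq_zero]
  rintro ⟨h, k⟩ e
  simp only [AddMonoidHom.coprod_apply, AddSubgroup.coe_subtype] at e
  have hh : (h : G) = -k := eq_neg_of_add_eq_zero_left e
  have h1 : addOrderOf (h : G) ∣ m := by
    rw [AddSubgroup.addOrderOf_coe, ← hH]; exact addOrderOf_dvd_natCard h
  have h2 : addOrderOf (h : G) ∣ q := by
    rw [hh, addOrderOf_neg, AddSubgroup.addOrderOf_coe, ← hK]; exact addOrderOf_dvd_natCard k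
  have h3 : (h : G) = 0 := AddMonoid.addOrderOf_eq_one_iff.mp
    (Nat.eq_one_of_dvd_coprimes hmq h1 h2)
  have h4 : (k : G) = 0 := by rw [h3] at e; simpa using e
  exact Prod.ext (Subtype.ext h3) (Subtype.ext h4)

theorem nonempty_klein_addEquiv {H : Type*} [AddCommGroup H] (hH : Nat.card H = 4)
    {x y : H} (hx : x ≠ 0) (hy : y ≠ 0) (hxy : x ≠ y) (hx2 : x + x = 0) (hy2 : y + y = 0) :
    Nonempty (ZMod 2 × ZMod 2 ≃+ H) := by
  classical
  have : Finite H := Nat.finite_of_card_ne_zero (by omega)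
  have := Fintype.ofFinite H
  rw [Nat.card_eq_fintype_card] at hH
  have h0 : x + y ≠ 0 := fun h => hxy ((eq_neg_of_add_eq_zero_left h).trans
    (eq_neg_of_add_eq_zero_left hy2).symm)
  -- These four distinct elements exhaust H, and each is killed by 2.
  have hs : ({0, x, y, x + y} : Finset H) = Finset.univ := by
    apply Finset.eq_univ_of_card
    rw [hH, Finset.card_insert_of_notMem (by simp [hx.symm, hy.symm, h0.symm]),
      Finset.card_insert_of_notMem (by simp [hxy, hy]),
      Finset.card_insert_of_notMem (by simp [hx]), Finset.card_singleton]
  have hz : ∀ z : H, z + z = 0 := fun z => by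
    have hz : z ∈ ({0, x, y, x + y} : Finset H) := hs ▸ Finset.mem_univ z
    simp only [Finset.mem_insert, Finset.mem_singleton] at hz
    rcases hz with rfl | rfl | rfl | rfl
    · simp
    · exact hx2
    · exact hy2
    · rw [add_add_add_comm, hx2, hy2, add_zero]
  have : IsAddKleinFour H :=
    { card_four := by rw [Nat.card_eq_fintype_card, hH]
      exponent_two := by
        have h1 : AddMonoid.exponent H ∣ 2 :=
          AddMonoid.exponent_dvd_of_forall_nsmul_eq_zero fun z => by rw [two_nsmul, hz]
        rcases (Nat.dvd_prime Nat.prime_two).mp h1 with h2 | h2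
        · have := AddMonoid.exponent_nsmul_eq_zero x
          rw [h2, one_nsmul] at this
          exact absurd this hx
        · exact h2 }
  exact IsAddKleinFour.nonempty_addEquiv

/-- The product of a `2`-group with two involutions and a nontrivial group of odd order has
a zero-sum array. -/
theorem hasZeroSumArray_prod {H L : Type*} [AddCommGroup H] [AddCommGroup L] {ℓ α : ℕ}
    (hℓ : 1 ≤ ℓ) (hα : 2 ≤ α) (hH : Nat.card H = 2 ^ α) (hL : Nat.card L = 2 * ℓ + 1)
    {x y : H} (hx : x ≠ 0) (hy : y ≠ 0) (hxy : x ≠ y) (hx2 : x + x = 0) (hy2 : y + y = 0) :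
    HasZeroSumArray (H × L) (Fin (2 * ℓ + 1)) (Fin (2 ^ α)) := by
  have : Finite H := Nat.finite_of_card_ne_zero (by rw [hH]; positivity)
  have : Finite L := Nat.finite_of_card_ne_zero (by omega)
  have := Fintype.ofFinite H
  have := Fintype.ofFinite L
  have hL' : Fintype.card L = 2 * ℓ + 1 := by rw [← Nat.card_eq_fintype_card, hL]
  have hH' : Fintype.card H = 2 ^ α := by rw [← Nat.card_eq_fintype_card, hH]
  let f : Fin (2 * ℓ + 1) ≃ L := Fintype.equivOfCardEq (by simp [hL'])
  rcases hα.eq_or_lt with rfl | hα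
  · obtain ⟨e⟩ := nonempty_klein_addEquiv hH hx hy hxy hx2 hy2
    rcases hℓ.eq_or_lt with rfl | hℓ
    · have : Fact (Nat.Prime 3) := ⟨Nat.prime_three⟩
      have : IsAddCyclic L := isAddCyclic_of_prime_card (p := 3) hL
      have hL3 : Nat.card L = 3 := hL
      have e' : ZMod 3 ≃+ L := (ZMod.ringEquivCongr hL3.symm).toAddEquiv.trans
        (zmodAddCyclicAddEquiv inferInstance)
      exact HasZeroSumArray.klein_prod_zmod_three.congr (e.prodCongr e') (Equiv.refl _)
        (Equiv.refl _)
    · exact (HasZeroSumArray.klein_prod (hL' ▸ ⟨ℓ, rfl⟩) (by omega)).congr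
        (e.prodCongr (AddEquiv.refl L)) f (Equiv.refl _)
  · obtain ⟨b, rfl⟩ := Nat.exists_eq_add_of_lt hα
    have h4 : Fintype.card H = 2 ^ (b + 2) + 2 ^ (b + 2) := by rw [hH']; ring
    have h5 : 3 ≤ 2 ^ (b + 2) := by
      have := Nat.one_le_two_pow (n := b)
      rw [pow_add]; omega
    exact (HasZeroSumArray.of_strongCompleteMapping h4 h5
      (.of_two_involutions hH hx hy hxy hx2 hy2) (hL' ▸ ⟨ℓ, rfl⟩) (by omega)).congr
      (AddEquiv.refl _) f (Fintype.equivOfCardEq (by simp [hH']))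

theorem mainTheorem2 {Γ : Type*} [AddCommGroup Γ] (ℓ α c : ℕ) (hℓ : 1 ≤ ℓ) (hα : 2 ≤ α)
    (hc : Odd c) (hΓ : InUpsilon Γ) (hcard : Nat.card Γ = (2 * ℓ + 1) * 2 ^ α * c) :
    ∃ R : Fin c → Matrix (Fin (2 * ℓ + 1)) (Fin (2 ^ α)) Γ,
      IsMRS (2 * ℓ + 1) (2 ^ α) c R := by
  obtain ⟨hfin, hinv⟩ := hΓ
  have hodd : Odd ((2 * ℓ + 1) * c) := Odd.mul ⟨ℓ, rfl⟩ hc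
  obtain ⟨H, K, hH, hK, ⟨e⟩⟩ := exists_prod_addEquiv_of_coprime (G := Γ) (m := 2 ^ α)
    (q := (2 * ℓ + 1) * c) (by rw [hcard]; ring)
    (Nat.Coprime.pow_left _ (Nat.coprime_two_left.mpr hodd))
  -- The order is even, so Cauchy's theorem excludes the case of no involution.
  have hinv2 : 1 < {g : Γ | addOrderOf g = 2}.ncard := by
    rcases hinv with h | h
    · obtain ⟨x, hx⟩ := exists_prime_addOrderOf_dvd_card' (G := Γ) 2 (by
        rw [hcard]
        exact ((dvd_pow_self 2 (by omega)).mul_left _).mul_right _)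
      rw [Set.ncard_eq_zero] at h
      exact absurd (h ▸ (show x ∈ {g : Γ | addOrderOf g = 2} from hx)) (Set.notMem_empty x)
    · exact h
  obtain ⟨x, hx, y, hy, hxy⟩ := (Set.one_lt_ncard).mp hinv2
  -- The K-part of an involution is killed by 2 in a group of odd order, so it vanishes.
  have hH2 : ∀ x : Γ, addOrderOf x = 2 → ∃ z : H, e (z, 0) = x ∧ z ≠ 0 ∧ z + z = 0 := by
    intro x hx
    have h1 : e.symm x + e.symm x = 0 := by
      rw [← map_add, ← two_nsmul, ← hx, addOrderOf_nsmul_eq_zero, map_zero]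
    have h2 : (e.symm x).2 = 0 := eq_zero_of_add_self_eq_zero (by rwa [hK])
      (congrArg Prod.snd h1)
    have h3 : e ((e.symm x).1, 0) = x := by
      rw [← h2]; simp
    refine ⟨(e.symm x).1, h3, fun h => ?_, congrArg Prod.fst h1⟩
    rw [h, ← Prod.zero_eq_mk, map_zero] at h3
    rw [← h3, addOrderOf_zero] at hx
    omega
  obtain ⟨u, hu, hu0, hu2⟩ := hH2 x hx
  obtain ⟨v, hv, hv0, hv2⟩ := hH2 y hy
  have huv : u ≠ v := by rintro rfl; exact hxy (hu.symm.trans hv)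
  obtain ⟨T, hT⟩ := exists_addSubgroup_card_eq c (G := K) (hK ▸ dvd_mul_left _ _)
  have hL : Nat.card (K ⧸ T) = 2 * ℓ + 1 := by
    have := AddSubgroup.card_eq_card_quotient_mul_card_addSubgroup T
    rw [hK, hT] at this
    exact (Nat.eq_of_mul_eq_mul_right hc.pos this).symm
  let π : H × K →+ H × (K ⧸ T) := (AddMonoidHom.id H).prodMap (QuotientAddGroup.mk' T)
  have hπ : Function.Surjective π :=
    Function.Surjective.prodMap Function.surjective_id (QuotientAddGroup.mk'_surjective T)
  have hker : Nat.card π.ker = c := by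
    have := AddSubgroup.card_mul_index π.ker
    rw [AddSubgroup.index_ker, AddMonoidHom.range_eq_top.mpr hπ, AddSubgroup.card_top,
      Nat.card_prod, Nat.card_prod, hH, hK, hL] at this
    refine Nat.eq_of_mul_eq_mul_right (show 0 < 2 ^ α * (2 * ℓ + 1) by positivity)
      (this.trans (by ring))
  have hα2 : Even (2 ^ α) := (even_two).pow_of_ne_zero (by omega)
  -- An odd number of signs cannot sum to zero: the alternating row signs sum to 1, so the -1 in row
  -- 1 is lowered to -2. The number of columns is even, and there alternating signs suffice.
  obtain ⟨R, hR, hRr, hRc⟩ := (hasZeroSumArray_prod hℓ hα hH hL hu0 hv0 huv hu2 hv2).exists_lift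
    π hπ (hker ▸ hc) (fun i : Fin (2 * ℓ + 1) => (-1) ^ (i : ℕ) - if i = 1 then 1 else 0)
    (fun j : Fin (2 ^ α) => (-1) ^ (j : ℕ))
    (fun i => by
      by_cases hi : i = 1
      · subst hi
        have : ((1 : Fin (2 * ℓ + 1)) : ℕ) = 1 := by
          rw [Fin.val_one']; exact Nat.mod_eq_of_lt (by omega)
        simp only [this, if_true, pow_one]
        norm_num
      · simp only [hi, if_false, sub_zero]
        rcases neg_one_pow_eq_or ℤ (i : ℕ) with h | h <;> simp [h])
    (fun j => neg_one_pow_eq_or ℤ (j : ℕ))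
    (by
      rw [Finset.sum_sub_distrib, Fin.sum_univ_eq_sum_range (fun i => (-1 : ℤ) ^ i),
        neg_one_geom_sum]
      simp)
    (by
      rw [Fin.sum_univ_eq_sum_range (fun i => (-1 : ℤ) ^ i), neg_one_geom_sum, if_pos hα2])
  have f : Fin c ≃ π.ker := (Finite.equivFinOfCardEq hker).symm
  refine ⟨fun t i j => e (R (f t) i j), hcard, fun g => ?_, ⟨0, fun t i => ?_⟩, ⟨0, fun t j => ?_⟩⟩
  · exact (e.bijective.comp (hR.comp (f.prodCongr (Equiv.refl _)).bijective)).existsUnique g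
  · rw [← map_sum, hRr, map_zero]
  · rw [← map_sum, hRc, map_zero]
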